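/- Let $S_0$ be the group of finitary permutations of $\mathbb Z$, i.e. of those permutations of $\mathbb Z$ that move only finitely many integers, and let $A_0 \lhd S_0$ be the subgroup of even permutations (products of an even number of transpositions). Let $\mathbb Z$ act on $S_0$ by the shift, i.e. $k \in \mathbb Z$ acts on $S_0$ as conjugation by the $k$-th power of $n \mapsto n+1$, and let $\Gamma = \mathbb Z \ltimes S_0$ be the corresponding semidirect product. Then the discrete group $\Gamma$ is amenable. Moreover, its finite residual $$\mathfrak R_{\mathcal F}(\Gamma) := \bigcap_{\substack{N \lhd \Gamma \\ \Gamma/N \text{ finite}}} N$$ is equal to $A_0$, regarded as a subgroup of $\Gamma$ through the inclusion $S_0 \subset \Gamma$. Hence $\Gamma$ is not residually finite. -/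

import Mathlib

open scoped ENNReal

/-- Left translate of a bounded real function `f` on a group: `(leftTranslate g f) x = f (g * x)`. -/
def leftTranslate {G : Type*} [Group G] (g : G) (f : lp (fun _ : G => ℝ) ∞) :
    lp (fun _ : G => ℝ) ∞ :=
  ⟨fun x => f (g * x), by
    refine memℓp_infty ?_
    obtain ⟨C, hC⟩ := memℓp_infty_iff.mp (lp.memℓp f)
    refine ⟨C, ?_⟩
    rintro _ ⟨x, rfl⟩
    exact hC ⟨g * x, rfl⟩⟩

/-- A discrete group is amenable if there is a left invariant mean on the space of its bounded
real functions: a linear functional that is positive, normalized and invariant under left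
translations. -/
def IsAmenableGroup (G : Type*) [Group G] : Prop :=
  ∃ m : lp (fun _ : G => ℝ) ∞ →ₗ[ℝ] ℝ,
    (∀ f, (∀ x, 0 ≤ f x) → 0 ≤ m f) ∧
    m 1 = 1 ∧
    ∀ (g : G) (f : lp (fun _ : G => ℝ) ∞), m (leftTranslate g f) = m f

/-- The finite residual of a group: the intersection of all normal subgroups with finite
quotient. -/
def finiteResidual (G : Type*) [Group G] : Subgroup G :=
  ⨅ (N : Subgroup G) (_ : N.Normal) (_ : Finite (G ⧸ N)), N

/-- The group `S₀` of finitary permutations of `ℤ`: those that move only finitely many integers. -/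
def finitaryPerm : Subgroup (Equiv.Perm ℤ) where
  carrier := {σ | {n : ℤ | σ n ≠ n}.Finite}
  one_mem' := by simp
  mul_mem' := by
    intro σ τ hσ hτ
    refine (Set.Finite.union hσ hτ).subset ?_
    intro n hn
    by_cases h : τ n = n
    · left
      simpa [h] using hn
    · right
      exact h
  inv_mem' := by
    intro σ hσ
    refine Set.Finite.subset hσ ?_
    intro n hn h
    exact hn (Equiv.Perm.inv_eq_iff_eq.mpr h.symm)

/-- The group of finitary permutations is normal in the group of all permutations of `ℤ`. -/
instance finitaryPerm_normal : finitaryPerm.Normal where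
  conj_mem := by
    intro σ hσ π
    refine (Set.Finite.image π hσ).subset ?_
    intro n hn
    refine ⟨π⁻¹ n, ?_, by simp⟩
    intro h
    apply hn
    rw [Equiv.Perm.mul_apply, Equiv.Perm.mul_apply, h]
    exact π.apply_symm_apply n

/-- The finitary alternating group `A₀`, as a subgroup of `S₀`: the even permutations in `S₀`,
that is, the products of an even number of transpositions. -/
def finitaryAlternating : Subgroup finitaryPerm where
  carrier := {σ | ∃ l : List (Equiv.Perm ℤ),
    (∀ τ ∈ l, τ.IsSwap) ∧ Even l.length ∧ l.prod = (σ : Equiv.Perm ℤ)}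
  one_mem' := ⟨[], by simp⟩
  mul_mem' := by
    rintro σ τ ⟨l, hl, hle, hlp⟩ ⟨k, hk, hke, hkp⟩
    refine ⟨l ++ k, ?_, ?_, ?_⟩
    · intro ρ hρ
      rcases List.mem_append.mp hρ with h | h
      · exact hl ρ h
      · exact hk ρ h
    · rw [List.length_append]
      exact hle.add hke
    · rw [List.prod_append, hlp, hkp, Subgroup.coe_mul]
  inv_mem' := by
    rintro σ ⟨l, hl, hle, hlp⟩
    refine ⟨(l.map fun τ => τ⁻¹).reverse, ?_, ?_, ?_⟩
    · intro ρ hρ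
      obtain ⟨τ, hτ, rfl⟩ := List.mem_map.mp (List.mem_reverse.mp hρ)
      obtain ⟨x, y, hxy, rfl⟩ := hl τ hτ
      exact ⟨x, y, hxy, Equiv.swap_inv x y⟩
    · simpa using hle
    · rw [← List.prod_inv_reverse, hlp, Subgroup.coe_inv]

/-- The action of `ℤ` on `S₀` by the shift `s : n ↦ n + 1`: the integer `k` acts on `S₀` as
conjugation by `s ^ k`, so that it maps `σ` to `n ↦ σ (n - k) + k`. -/
def shiftAction : Multiplicative ℤ →* MulAut finitaryPerm :=
  MulAut.conjNormal.comp (zpowersHom (Equiv.Perm ℤ) (Equiv.addRight (1 : ℤ)))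

/-- The semidirect product `Γ = ℤ ⋉ S₀` for the shift action. -/
abbrev ShiftFinitary : Type := finitaryPerm ⋊[shiftAction] Multiplicative ℤ

/-! Amenability: the boxes of elements s ^ k * σ with 0 ≤ k ≤ n and σ supported in [-2n, 2n] form a
Følner sequence. Left translation by the shift changes only the end fibres, and a fixed τ ∈ S₀
permutes each fibre once n is large. An ultrafilter limit of the box averages is an invariant mean
(`IsAmenableGroup.of_tendsto`).

Residual: by pigeonhole, a homomorphism from S₀ to a finite group identifies two transpositions (0
a) and (0 b). Conjugation then makes it constant on all transpositions, with a value of square 1, so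
it kills A₀ (`finitaryAlternating_le_ker`). Conversely, ℤ ⋉ A₀ has finite index and ℤ is residually
finite, so nothing outside A₀ survives. A 3-cycle in A₀ rules out residual finiteness. -/

open Filter Topology

/-! ### Invariant means as ultrafilter limits -/

section Mean

/-- A positive normalized functional on the bounded functions is contractive. -/
theorem abs_le_norm_of_positive {X : Type*} {m : lp (fun _ : X => ℝ) ∞ →ₗ[ℝ] ℝ}
    (pos : ∀ f, (∀ x, 0 ≤ f x) → 0 ≤ m f) (one : m 1 = 1) (f : lp (fun _ : X => ℝ) ∞) :
    |m f| ≤ ‖f‖ := by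
  have key (x : X) : |f x| ≤ ‖f‖ := lp.norm_apply_le_norm ENNReal.top_ne_zero f x
  have h1 : 0 ≤ m (‖f‖ • 1 - f) := pos _ fun x => by
    have := (abs_le.mp (key x)).2
    simp only [lp.coeFn_sub, lp.coeFn_smul, lp.infty_coeFn_one, Pi.sub_apply, Pi.smul_apply,
      Pi.one_apply, smul_eq_mul, mul_one]
    linarith
  have h2 : 0 ≤ m (‖f‖ • 1 + f) := pos _ fun x => by
    have := (abs_le.mp (key x)).1
    simp only [lp.coeFn_add, lp.coeFn_smul, lp.infty_coeFn_one, Pi.add_apply, Pi.smul_apply,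
      Pi.one_apply, smul_eq_mul, mul_one]
    linarith
  rw [map_sub, map_smul, one, smul_eq_mul, mul_one] at h1
  rw [map_add, map_smul, one, smul_eq_mul, mul_one] at h2
  exact abs_le.mpr ⟨by linarith, by linarith⟩

variable {G : Type*} [Group G]

@[simp]
theorem leftTranslate_apply (g : G) (f : lp (fun _ : G => ℝ) ∞) (x : G) :
    leftTranslate g f x = f (g * x) := rfl

theorem leftTranslate_leftTranslate (g h : G) (f : lp (fun _ : G => ℝ) ∞) :
    leftTranslate g (leftTranslate h f) = leftTranslate (h * g) f := by
  ext x
  simp [mul_assoc]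

theorem leftTranslate_one (f : lp (fun _ : G => ℝ) ∞) : leftTranslate 1 f = f := by
  ext x
  simp

/-- A sequence of means which is asymptotically invariant under a generating set yields an
invariant mean. -/
theorem IsAmenableGroup.of_tendsto (m : ℕ → lp (fun _ : G => ℝ) ∞ →ₗ[ℝ] ℝ)
    (pos : ∀ n f, (∀ x, 0 ≤ f x) → 0 ≤ m n f) (one : ∀ n, m n 1 = 1)
    {S : Set G} (hS : Subgroup.closure S = ⊤)
    (inv : ∀ g ∈ S, ∀ f, Tendsto (fun n => m n (leftTranslate g f) - m n f) atTop (𝓝 0)) :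
    IsAmenableGroup G := by
  -- The values lie in the compact interval [-‖f‖, ‖f‖], so they converge along a fixed nonprincipal
  -- ultrafilter; uniqueness of limits gives linearity.
  have ex (f : lp (fun _ : G => ℝ) ∞) :
      ∃ a, Tendsto (fun n => m n f) (hyperfilter ℕ : Filter ℕ) (𝓝 a) := by
    obtain ⟨a, -, ha⟩ := (isCompact_Icc (a := -‖f‖) (b := ‖f‖)).ultrafilter_le_nhds
      ((hyperfilter ℕ).map fun n => m n f) (by
        rw [le_principal_iff]
        exact Filter.Eventually.of_forall (f := (hyperfilter ℕ : Filter ℕ)) fun n =>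
          abs_le.mp (abs_le_norm_of_positive (pos n) (one n) f))
    exact ⟨a, ha⟩
  choose L hL using ex
  let M : lp (fun _ : G => ℝ) ∞ →ₗ[ℝ] ℝ :=
    { toFun := L
      map_add' := fun f g => tendsto_nhds_unique (hL (f + g))
        (by simpa only [map_add] using (hL f).add (hL g))
      map_smul' := fun c f => tendsto_nhds_unique (hL (c • f))
        (by simpa only [map_smul, RingHom.id_apply] using (hL f).const_smul c) }
  let H : Subgroup G :=
    { carrier := {g | ∀ f, M (leftTranslate g f) = M f}
      one_mem' := fun f => by rw [leftTranslate_one]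
      mul_mem' := fun {a b} ha hb f => by
        rw [← leftTranslate_leftTranslate, hb, ha]
      inv_mem' := fun {a} ha f => by
        rw [← ha, leftTranslate_leftTranslate, inv_mul_cancel, leftTranslate_one] }
  have hH : H = ⊤ := by
    rw [eq_top_iff, ← hS, Subgroup.closure_le]
    intro g hg f
    have h := tendsto_nhds_unique ((hL (leftTranslate g f)).sub (hL f))
      ((inv g hg f).mono_left Nat.hyperfilter_le_atTop)
    exact sub_eq_zero.mp h
  refine ⟨M, fun f hf => ge_of_tendsto' (hL f) fun n => pos n f hf, ?_, fun g => ?_⟩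
  · exact tendsto_nhds_unique (hL 1) (by simp only [one]; exact tendsto_const_nhds)
  · exact hH.ge (Subgroup.mem_top g)

end Mean

/-! ### Følner averages on Γ -/

section Amenable

theorem shiftAction_apply (k : ℤ) (σ : finitaryPerm) (x : ℤ) :
    (shiftAction (Multiplicative.ofAdd k) σ : Equiv.Perm ℤ) x =
      (σ : Equiv.Perm ℤ) (x - k) + k := by
  simp [shiftAction, MulAut.conjNormal_apply, sub_eq_add_neg]

/-- The subgroup of the permutations supported in the interval `[-r, r]`. -/
def intervalPerm (r : ℕ) : Subgroup finitaryPerm where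
  carrier := {σ | ∀ x : ℤ, (r : ℤ) < |x| → (σ : Equiv.Perm ℤ) x = x}
  one_mem' := fun x _ => rfl
  mul_mem' := fun {σ τ} hσ hτ x hx => by
    rw [Subgroup.coe_mul, Equiv.Perm.mul_apply, hτ x hx, hσ x hx]
  inv_mem' := fun {σ} hσ x hx => by
    rw [Subgroup.coe_inv, Equiv.Perm.inv_eq_iff_eq, hσ x hx]

instance finite_intervalPerm (r : ℕ) : Finite (intervalPerm r) := by
  have : Finite {x : ℤ // |x| ≤ r} :=
    ((Set.finite_Icc (-(r : ℤ)) r).subset fun x hx => abs_le.mp hx).to_subtype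
  have : Finite {f : Equiv.Perm ℤ // ∀ x : ℤ, ¬ |x| ≤ (r : ℤ) → f x = x} :=
    Finite.of_equiv _ (Equiv.Perm.subtypeEquivSubtypePerm fun x : ℤ => |x| ≤ r)
  refine Finite.of_injective
    (fun σ : intervalPerm r => (⟨σ.1.1, fun x hx => σ.2 x (not_le.mp hx)⟩ :
      {f : Equiv.Perm ℤ // ∀ x : ℤ, ¬ |x| ≤ (r : ℤ) → f x = x})) fun σ τ h => ?_
  have h' := Subtype.ext_iff.mp h
  exact Subtype.ext (Subtype.ext h')

noncomputable instance fintype_intervalPerm (r : ℕ) : Fintype (intervalPerm r) :=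
  Fintype.ofFinite _

theorem exists_forall_lt_abs_apply_eq (σ : finitaryPerm) : ∃ r : ℕ, ∀ x : ℤ,
    (r : ℤ) < |x| → (σ : Equiv.Perm ℤ) x = x := by
  obtain ⟨r, hr⟩ := (σ.2.image Int.natAbs).bddAbove
  refine ⟨r, fun x hx => ?_⟩
  by_contra h
  have : x.natAbs ≤ r := hr ⟨x, h, rfl⟩
  rw [Int.abs_eq_natAbs] at hx
  omega

theorem ShiftFinitary.inl_mul_inr (τ : finitaryPerm) (k : ℤ) :
    (SemidirectProduct.inl τ * SemidirectProduct.inr (Multiplicative.ofAdd k) : ShiftFinitary) =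
      SemidirectProduct.inr (Multiplicative.ofAdd k) *
        SemidirectProduct.inl (shiftAction (Multiplicative.ofAdd (-k)) τ) := by
  ext1
  · simp [ofAdd_neg]
  · simp

/-- The average of a bounded function over the elements `s ^ k * σ` with `σ` supported in
`[-r, r]`. -/
noncomputable def fiberAverage (r : ℕ) (k : ℤ) : lp (fun _ : ShiftFinitary => ℝ) ∞ →ₗ[ℝ] ℝ where
  toFun f := (Fintype.card (intervalPerm r) : ℝ)⁻¹ * ∑ σ : intervalPerm r,
    f (SemidirectProduct.inr (Multiplicative.ofAdd k) * SemidirectProduct.inl σ.1)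
  map_add' f g := by
    simp only [lp.coeFn_add, Pi.add_apply, Finset.sum_add_distrib, mul_add]
  map_smul' c f := by
    simp only [lp.coeFn_smul, Pi.smul_apply, smul_eq_mul, ← Finset.mul_sum, RingHom.id_apply]
    ring

theorem fiberAverage_apply (r : ℕ) (k : ℤ) (f : lp (fun _ : ShiftFinitary => ℝ) ∞) :
    fiberAverage r k f = (Fintype.card (intervalPerm r) : ℝ)⁻¹ * ∑ σ : intervalPerm r,
      f (SemidirectProduct.inr (Multiplicative.ofAdd k) * SemidirectProduct.inl σ.1) := rfl

theorem fiberAverage_nonneg (r : ℕ) (k : ℤ) (f : lp (fun _ : ShiftFinitary => ℝ) ∞)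
    (hf : ∀ x, 0 ≤ f x) : 0 ≤ fiberAverage r k f :=
  mul_nonneg (by positivity) (Finset.sum_nonneg fun _ _ => hf _)

theorem fiberAverage_one (r : ℕ) (k : ℤ) : fiberAverage r k 1 = 1 := by
  have : (Fintype.card (intervalPerm r) : ℝ) ≠ 0 := Nat.cast_ne_zero.mpr Fintype.card_ne_zero
  simp [fiberAverage_apply, lp.infty_coeFn_one, this]

theorem fiberAverage_leftTranslate_inr (r : ℕ) (k : ℤ) (f : lp (fun _ : ShiftFinitary => ℝ) ∞) :
    fiberAverage r k
      (leftTranslate (SemidirectProduct.inr (Multiplicative.ofAdd 1)) f) =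
    fiberAverage r (k + 1) f := by
  simp only [fiberAverage_apply, leftTranslate_apply, ← mul_assoc, ← map_mul, ← ofAdd_add,
    add_comm 1 k]

/-- Moving τ past s ^ k conjugates it into the finite group being averaged over, where left
multiplication only permutes the summands. -/
theorem fiberAverage_leftTranslate_inl {r : ℕ} {k : ℤ} {τ : finitaryPerm}
    (hτ : shiftAction (Multiplicative.ofAdd (-k)) τ ∈ intervalPerm r)
    (f : lp (fun _ : ShiftFinitary => ℝ) ∞) :
    fiberAverage r k (leftTranslate (SemidirectProduct.inl τ) f) = fiberAverage r k f := by
  simp only [fiberAverage_apply, leftTranslate_apply, ← mul_assoc, ShiftFinitary.inl_mul_inr]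
  congr 1
  refine Fintype.sum_equiv (Equiv.mulLeft ⟨_, hτ⟩) _ _ fun σ => ?_
  simp [mul_assoc]

/-- The average of a bounded function over the elements `s ^ k * σ` with `0 ≤ k ≤ n` and `σ`
supported in `[-2n, 2n]`. -/
noncomputable def boxAverage (n : ℕ) : lp (fun _ : ShiftFinitary => ℝ) ∞ →ₗ[ℝ] ℝ :=
  ((n : ℝ) + 1)⁻¹ • ∑ k ∈ Finset.range (n + 1), fiberAverage (2 * n) k

theorem boxAverage_apply (n : ℕ) (f : lp (fun _ : ShiftFinitary => ℝ) ∞) :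
    boxAverage n f =
      ((n : ℝ) + 1)⁻¹ * ∑ k ∈ Finset.range (n + 1), fiberAverage (2 * n) k f := by
  simp [boxAverage]

theorem tendsto_boxAverage_inr (f : lp (fun _ : ShiftFinitary => ℝ) ∞) :
    Tendsto (fun n => boxAverage n
      (leftTranslate (SemidirectProduct.inr (Multiplicative.ofAdd 1)) f) - boxAverage n f)
      atTop (𝓝 0) := by
  have bound (r : ℕ) (k : ℤ) : |fiberAverage r k f| ≤ ‖f‖ :=
    abs_le_norm_of_positive (fiberAverage_nonneg r k) (fiberAverage_one r k) f
  have lim : Tendsto (fun n : ℕ => 1 / ((n : ℝ) + 1) * (2 * ‖f‖)) atTop (𝓝 0) := by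
    simpa using tendsto_one_div_add_atTop_nhds_zero_nat.mul_const (2 * ‖f‖)
  refine squeeze_zero_norm (fun n => ?_) lim
  -- The shift sends fibre k to fibre k + 1, so the difference telescopes to two end terms, each at
  -- most ‖f‖, divided by n + 1.
  have tele := Finset.sum_range_sub (fun k : ℕ => fiberAverage (2 * n) k f) (n + 1)
  simp only [boxAverage_apply, fiberAverage_leftTranslate_inr, ← mul_sub,
    ← Finset.sum_sub_distrib]
  push_cast at tele ⊢
  rw [tele, norm_mul, one_div, Real.norm_of_nonneg (by positivity), Real.norm_eq_abs]
  gcongr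
  have h1 := abs_le.mp (bound (2 * n) ((n : ℤ) + 1))
  have h2 := abs_le.mp (bound (2 * n) 0)
  exact abs_le.mpr ⟨by linarith, by linarith⟩

theorem tendsto_boxAverage_inl (τ : finitaryPerm) (f : lp (fun _ : ShiftFinitary => ℝ) ∞) :
    Tendsto (fun n => boxAverage n (leftTranslate (SemidirectProduct.inl τ) f) - boxAverage n f)
      atTop (𝓝 0) := by
  obtain ⟨r, hr⟩ := exists_forall_lt_abs_apply_eq τ
  -- The difference vanishes for n ≥ r: if |x| > 2n and 0 ≤ k ≤ n, then |x + k| > n ≥ r. This is why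
  -- the interval has radius 2n.
  refine tendsto_const_nhds.congr' ?_
  filter_upwards [eventually_ge_atTop r] with n hn
  rw [eq_comm, sub_eq_zero, boxAverage_apply, boxAverage_apply]
  congr 1
  refine Finset.sum_congr rfl fun k hk => fiberAverage_leftTranslate_inl (fun x hx => ?_) f
  have hk' := Finset.mem_range.mp hk
  rw [shiftAction_apply, hr]
  · ring
  · push_cast at hx
    rw [lt_abs] at hx ⊢
    omega

theorem isAmenableGroup_shiftFinitary : IsAmenableGroup ShiftFinitary := by
  refine IsAmenableGroup.of_tendsto boxAverage (fun n f hf => ?_) (fun n => ?_)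
    (S := insert (SemidirectProduct.inr (Multiplicative.ofAdd 1)) (Set.range SemidirectProduct.inl))
    ?_ ?_
  · rw [boxAverage_apply]
    exact mul_nonneg (by positivity) (Finset.sum_nonneg fun k _ => fiberAverage_nonneg _ _ f hf)
  · simp only [boxAverage_apply, fiberAverage_one, Finset.sum_const, Finset.card_range,
      nsmul_eq_mul, mul_one, Nat.cast_add, Nat.cast_one]
    exact inv_mul_cancel₀ (by positivity)
  · rw [eq_top_iff]
    intro g _
    rw [← SemidirectProduct.inl_left_mul_inr_right g]
    refine mul_mem (Subgroup.subset_closure (Set.mem_insert_of_mem _ ⟨_, rfl⟩)) ?_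
    have : g.right = Multiplicative.ofAdd 1 ^ g.right.toAdd := by
      rw [← ofAdd_zsmul]
      simp
    rw [this, map_zpow]
    exact Subgroup.zpow_mem _ (Subgroup.subset_closure (Set.mem_insert _ _)) _
  · rintro g (rfl | ⟨τ, rfl⟩) f
    · exact tendsto_boxAverage_inr f
    · exact tendsto_boxAverage_inl τ f

end Amenable

/-! ### The finite residual -/

section Residual

/-- The finite residual lies in every subgroup of finite index, normal or not. -/
theorem finiteResidual_le {G : Type*} [Group G] (H : Subgroup G) [H.FiniteIndex] :
    finiteResidual G ≤ H :=
  fun g hg => by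
    simp only [finiteResidual, Subgroup.mem_iInf] at hg
    exact H.normalCore_le (hg H.normalCore inferInstance inferInstance)

theorem swap_mem_finitaryPerm (x y : ℤ) : Equiv.swap x y ∈ finitaryPerm := by
  refine (Set.toFinite {x, y}).subset fun n hn => ?_
  by_contra h
  simp only [Set.mem_insert_iff, Set.mem_singleton_iff, not_or] at h
  exact hn (Equiv.swap_apply_of_ne_of_ne h.1 h.2)

/-- The transposition of `x` and `y` as a finitary permutation. -/
def finitarySwap (x y : ℤ) : finitaryPerm := ⟨Equiv.swap x y, swap_mem_finitaryPerm x y⟩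

theorem finitarySwap_mul_self (x y : ℤ) : finitarySwap x y * finitarySwap x y = 1 :=
  Subtype.ext (Equiv.swap_mul_self x y)

theorem finitarySwap_comm (x y : ℤ) : finitarySwap x y = finitarySwap y x :=
  Subtype.ext (Equiv.swap_comm x y)

theorem finitarySwap_mul_swap_mul_swap {x y z : ℤ} (hxy : x ≠ y) (hxz : x ≠ z) :
    finitarySwap y z * finitarySwap x y * finitarySwap y z = finitarySwap z x :=
  Subtype.ext (Equiv.swap_mul_swap_mul_swap hxy hxz)

/-- A homomorphism from the finitary permutations to a finite group takes the same value on all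
transpositions. -/
theorem exists_forall_map_finitarySwap {Q : Type*} [Group Q] [Finite Q] (φ : finitaryPerm →* Q) :
    ∃ c : Q, c * c = 1 ∧ ∀ x y : ℤ, x ≠ y → φ (finitarySwap x y) = c := by
  obtain ⟨i, j, hij, h⟩ := Finite.exists_ne_map_eq_of_infinite
    fun n : ℕ => φ (finitarySwap 0 ((n : ℤ) + 1))
  set a : ℤ := (i : ℤ) + 1 with ha
  set b : ℤ := (j : ℤ) + 1 with hb
  have hab : a ≠ b := by omega
  have ha0 : (0 : ℤ) ≠ a := by omega
  have hb0 : (0 : ℤ) ≠ b := by omega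
  have h0 (k : ℤ) (hk : 0 ≠ k) : φ (finitarySwap 0 k) = φ (finitarySwap 0 a) := by
    by_cases hka : k = a
    · rw [hka]
    by_cases hkb : k = b
    · rw [hkb]; exact h.symm
    -- Conjugation by (b k) fixes (0 a), which is disjoint from it, but takes (0 b) to (0 k); as φ
    -- agrees on (0 a) and (0 b), it agrees on (0 k) too.
    have e1 : φ (finitarySwap b k * finitarySwap 0 a * finitarySwap b k) =
        φ (finitarySwap 0 a) := by
      congr 1
      refine Subtype.ext ?_
      have hd : Equiv.swap b k * Equiv.swap 0 a = Equiv.swap 0 a * Equiv.swap b k := by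
        rw [Equiv.mul_swap_eq_swap_mul, Equiv.swap_apply_of_ne_of_ne hb0 hk,
          Equiv.swap_apply_of_ne_of_ne hab (Ne.symm hka)]
      change Equiv.swap b k * Equiv.swap 0 a * Equiv.swap b k = Equiv.swap 0 a
      rw [hd, mul_assoc, Equiv.swap_mul_self, mul_one]
    have e2 := finitarySwap_mul_swap_mul_swap hb0 hk
    rw [finitarySwap_comm, ← e2, ← e1]
    simp only [map_mul]
    rw [show φ (finitarySwap 0 a) = φ (finitarySwap 0 b) from h]
  have hc : φ (finitarySwap 0 a) * φ (finitarySwap 0 a) = 1 := by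
    rw [← map_mul, finitarySwap_mul_self, map_one]
  refine ⟨φ (finitarySwap 0 a), hc, fun x y hxy => ?_⟩
  by_cases hx : 0 = x
  · exact hx ▸ h0 y (by omega)
  by_cases hy : 0 = y
  · rw [finitarySwap_comm]
    exact hy ▸ h0 x hx
  -- Here (x y) = (0 x)(y 0)(0 x), with image c * c * c = c.
  rw [← finitarySwap_mul_swap_mul_swap (Ne.symm hy) hxy.symm, finitarySwap_comm y 0]
  simp only [map_mul, h0 x hx, h0 y hy, hc, one_mul]

/-- A homomorphism from the finitary permutations to a finite group is trivial on the even
permutations. -/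
theorem finitaryAlternating_le_ker {Q : Type*} [Group Q] [Finite Q] (φ : finitaryPerm →* Q) :
    finitaryAlternating ≤ φ.ker := by
  obtain ⟨c, hc, hφ⟩ := exists_forall_map_finitarySwap φ
  have key (l : List (Equiv.Perm ℤ)) (hl : ∀ τ ∈ l, τ.IsSwap) :
      ∃ h : l.prod ∈ finitaryPerm, φ ⟨l.prod, h⟩ = c ^ l.length := by
    induction l with
    | nil => exact ⟨one_mem finitaryPerm, (map_one φ).trans (pow_zero c).symm⟩
    | cons τ l ih =>
      obtain ⟨x, y, hxy, rfl⟩ := hl τ List.mem_cons_self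
      obtain ⟨h, hl'⟩ := ih fun ρ hρ => hl ρ (List.mem_cons_of_mem _ hρ)
      refine ⟨by rw [List.prod_cons]; exact mul_mem (swap_mem_finitaryPerm x y) h, ?_⟩
      rw [List.length_cons, pow_succ', ← hl', ← hφ x y hxy, ← map_mul]
      rfl
  rintro σ ⟨l, hl, ⟨k, hk⟩, hlp⟩
  obtain ⟨h, hl'⟩ := key l hl
  have hσ : σ = ⟨l.prod, h⟩ := Subtype.ext hlp.symm
  rw [MonoidHom.mem_ker, hσ, hl', hk, ← two_mul, pow_mul, pow_two, hc, one_pow]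

theorem shiftAction_mem_finitaryAlternating (k : Multiplicative ℤ) {σ : finitaryPerm}
    (hσ : σ ∈ finitaryAlternating) : shiftAction k σ ∈ finitaryAlternating := by
  obtain ⟨l, hl, hle, hlp⟩ := hσ
  let c : MulAut (Equiv.Perm ℤ) :=
    MulAut.conj (zpowersHom (Equiv.Perm ℤ) (Equiv.addRight (1 : ℤ)) k)
  refine ⟨l.map c, fun τ hτ => ?_, by simpa using hle, ?_⟩
  · obtain ⟨ρ, hρ, rfl⟩ := List.mem_map.mp hτ
    obtain ⟨x, y, hxy, rfl⟩ := hl ρ hρ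
    exact ⟨_, _, (Equiv.injective _).ne hxy, (Equiv.swap_apply_apply _ x y).symm⟩
  · rw [List.prod_hom, hlp]
    rfl

/-- Transpositions generate S₀, and (0 1) corrects an odd length; hence A₀ has at most two cosets.
-/
theorem mem_finitaryAlternating_or (σ : finitaryPerm) :
    σ ∈ finitaryAlternating ∨ finitarySwap 0 1 * σ ∈ finitaryAlternating := by
  obtain ⟨l, hl, hlp⟩ : ∃ l : List (Equiv.Perm ℤ),
      (∀ τ ∈ l, τ.IsSwap) ∧ l.prod = (σ : Equiv.Perm ℤ) := by
    have h : (σ : Equiv.Perm ℤ) ∈ Subgroup.closure {τ : Equiv.Perm ℤ | τ.IsSwap} :=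
      mem_closure_isSwap'.mpr σ.2
    rw [← Subgroup.mem_toSubmonoid, Subgroup.closure_toSubmonoid] at h
    obtain ⟨l, hl, hlp⟩ := Submonoid.exists_list_of_mem_closure h
    refine ⟨l, fun τ hτ => ?_, hlp⟩
    obtain h | ⟨x, y, hxy, h⟩ := hl τ hτ
    · exact h
    · exact ⟨x, y, hxy, by rw [← inv_inv τ, h, Equiv.swap_inv]⟩
  rcases Nat.even_or_odd l.length with he | ho
  · exact Or.inl ⟨l, hl, he, hlp⟩
  · refine Or.inr ⟨Equiv.swap 0 1 :: l, fun τ hτ => ?_, ho.add_one, ?_⟩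
    · rcases List.mem_cons.mp hτ with rfl | h
      · exact ⟨0, 1, by norm_num, rfl⟩
      · exact hl τ h
    · rw [List.prod_cons, hlp]
      rfl

/-- The subgroup `ℤ ⋉ A₀` of `ℤ ⋉ S₀`. -/
def shiftAlternating : Subgroup ShiftFinitary where
  carrier := {g | g.left ∈ finitaryAlternating}
  one_mem' := one_mem finitaryAlternating
  mul_mem' := fun ha hb => mul_mem ha (shiftAction_mem_finitaryAlternating _ hb)
  inv_mem' := fun ha => shiftAction_mem_finitaryAlternating _ (inv_mem ha)

instance finiteIndex_shiftAlternating : shiftAlternating.FiniteIndex := by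
  let w : ShiftFinitary := SemidirectProduct.inl (finitarySwap 0 1)
  have : Finite (ShiftFinitary ⧸ shiftAlternating) := by
    refine Finite.of_surjective
      (fun b : Bool => (QuotientGroup.mk (cond b 1 w⁻¹) : ShiftFinitary ⧸ shiftAlternating))
      fun q => ?_
    induction q using QuotientGroup.induction_on with
    | H g =>
      rcases mem_finitaryAlternating_or g.left with h | h
      · refine ⟨true, QuotientGroup.eq.mpr ?_⟩
        change (1⁻¹ * g).left ∈ finitaryAlternating
        simpa using h
      · refine ⟨false, QuotientGroup.eq.mpr ?_⟩
        change (w⁻¹⁻¹ * g).left ∈ finitaryAlternating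
        simpa [w] using h
  exact Subgroup.finiteIndex_of_finite_quotient

theorem right_eq_one_of_mem_finiteResidual {g : ShiftFinitary}
    (hg : g ∈ finiteResidual ShiftFinitary) : g.right = 1 := by
  -- A positive modulus exceeding the absolute value of the ℤ-component, so divisibility forces that
  -- component to vanish.
  let n : ℕ := g.right.toAdd.natAbs + 1
  let φ : ShiftFinitary →* Multiplicative (ZMod n) :=
    (AddMonoidHom.toMultiplicative (Int.castAddHom (ZMod n))).comp SemidirectProduct.rightHom
  have h : φ g = 1 := finiteResidual_le φ.ker hg
  have h' : ((g.right.toAdd : ℤ) : ZMod n) = 0 := h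
  rw [ZMod.intCast_zmod_eq_zero_iff_dvd] at h'
  have h0 : g.right.toAdd = 0 := Int.eq_zero_of_abs_lt_dvd h' (by
    rw [Int.abs_eq_natAbs]; omega)
  exact toAdd_eq_zero.mp h0

theorem finiteResidual_shiftFinitary :
    finiteResidual ShiftFinitary = finitaryAlternating.map SemidirectProduct.inl := by
  refine le_antisymm (fun g hg => ?_) ?_
  · refine ⟨g.left, finiteResidual_le shiftAlternating hg, ?_⟩
    rw [← SemidirectProduct.inl_left_mul_inr_right g, right_eq_one_of_mem_finiteResidual hg]
    simp
  · refine le_iInf fun N => le_iInf fun _ => le_iInf fun _ => ?_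
    rw [Subgroup.map_le_iff_le_comap]
    intro σ hσ
    have h := finitaryAlternating_le_ker
      ((QuotientGroup.mk' N).comp (SemidirectProduct.inl : finitaryPerm →* ShiftFinitary)) hσ
    exact (QuotientGroup.eq_one_iff (SemidirectProduct.inl σ : ShiftFinitary)).mp h

theorem not_residuallyFinite_shiftFinitary : ¬ Group.ResiduallyFinite ShiftFinitary := by
  intro h
  -- A 3-cycle: even, and nontrivial because it sends 2 to 0.
  let σ : finitaryPerm := finitarySwap 0 1 * finitarySwap 1 2
  have hσ : σ ∈ finitaryAlternating := by
    refine ⟨[Equiv.swap 0 1, Equiv.swap 1 2], fun τ hτ => ?_, by simp, by simp [σ, finitarySwap]⟩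
    simp only [List.mem_cons, List.not_mem_nil, or_false] at hτ
    rcases hτ with rfl | rfl
    · exact ⟨0, 1, by norm_num, rfl⟩
    · exact ⟨1, 2, by norm_num, rfl⟩
  have hres : SemidirectProduct.inl σ ∈ finiteResidual ShiftFinitary := by
    rw [finiteResidual_shiftFinitary]
    exact ⟨σ, hσ, rfl⟩
  have h1 : (SemidirectProduct.inl σ : ShiftFinitary) = 1 :=
    Group.residuallyFinite_iff_forall_finiteIndex.mp h _ fun H _ => finiteResidual_le H hres
  have h2 : σ = 1 := congrArg SemidirectProduct.left h1
  have h3 : (σ : Equiv.Perm ℤ) 2 = 2 := by rw [h2]; rfl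
  have h4 : (σ : Equiv.Perm ℤ) 2 = 0 := by
    change Equiv.swap (0 : ℤ) 1 (Equiv.swap 1 2 2) = 0
    rw [Equiv.swap_apply_right, Equiv.swap_apply_right]
  omega

end Residual

theorem lemma8p6 :
    IsAmenableGroup ShiftFinitary ∧
    finiteResidual ShiftFinitary = finitaryAlternating.map SemidirectProduct.inl ∧
    ¬ Group.ResiduallyFinite ShiftFinitary :=
  ⟨isAmenableGroup_shiftFinitary, finiteResidual_shiftFinitary,
    not_residuallyFinite_shiftFinitary⟩
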